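/- Conventions. For a group $G$ with a finite generating set $S$, let $\phi:F(S)\to G$ be the canonical map from the free group on $S$. For a finite set $\mathcal R\subset\ker\phi$ of $S$-relations, let $\Gamma(G,S,\mathcal R)$ be the 2-complex obtained from the Cayley graph of $G$ with respect to $S$ (one edge from $g$ to $gs$ for each $g\in G$, $s\in S$) by attaching, at each vertex $g$ and for each $r\in\mathcal R$, a 2-cell along the edge path loop that starts at $g$ and has label $r$. A proper edge path ray in a locally finite complex $X$ is a proper map $r:[0,\infty)\to X$ that maps each interval $[n,n+1]$, $n\ge 0$ an integer, linearly onto an edge of $X$ (in either direction). A connected, one-ended, locally finite complex $X$ is semistable at $\infty$ if any two proper edge path rays $r,r'$ in $X$ are properly homotopic, i.e. there is a proper map $H:[0,\infty)\times[0,1]\to X$ with $H(t,0)=r(t)$ and $H(t,1)=r'(t)$ for all $t$. A finitely generated one-ended group $G$ is semistable at $\infty$ if for some finite generating set $S$ of $G$ and some finite set $\mathcal R$ of $S$-relations, $\Gamma(G,S,\mathcal R)$ is semistable at $\infty$. Theorem. Let $L=\langle a,x : a^2,\ [a,x^{-k}ax^k]\ (k\in\mathbb Z)\rangle$ be the Lamplighter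 group (it is one-ended). Then $L$ is not semistable at $\infty$. Moreover, for every finite set $\mathcal R$ of relations of $L$ in the generators $a,x$, the 2-complex $\Gamma(L,\{a,x\},\mathcal R)$ is not semistable at $\infty$. -/

import Mathlib

open scoped NNReal unitInterval commutatorElement

noncomputable section

/-! ### Semistability at infinity -/

section Semistability

variable {X ε : Type*} [TopologicalSpace X]

/-- A proper edge path ray `[0, ∞) → X` in a complex `X` whose edges have characteristic maps
`e k : [0, 1] → X`: a proper map that traverses, on each interval `[n, n + 1]`, one edge of `X`
linearly, in one of its two directions. -/
def IsProperEdgePathRay (e : ε → I → X) (r : ℝ≥0 → X) : Prop :=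
  IsProperMap r ∧
    ∀ n : ℕ, ∃ k : ε,
      (∀ t : I, r ((n : ℝ≥0) + unitInterval.toNNReal t) = e k t) ∨
      (∀ t : I, r ((n : ℝ≥0) + unitInterval.toNNReal t) = e k (unitInterval.symm t))

/-- Two maps `[0, ∞) → X` are properly homotopic if they are the two ends of a proper map
`[0, ∞) × [0, 1] → X`. -/
def ProperlyHomotopic (r r' : ℝ≥0 → X) : Prop :=
  ∃ H : ℝ≥0 × I → X, IsProperMap H ∧ (∀ t, H (t, 0) = r t) ∧ (∀ t, H (t, 1) = r' t)

/-- Semistability at infinity of a (connected, one-ended, locally finite) complex `X` whose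
edges have characteristic maps `e k`: any two proper edge path rays are properly homotopic. -/
def SemistableAtInfinity (e : ε → I → X) : Prop :=
  ∀ r r' : ℝ≥0 → X, IsProperEdgePathRay e r → IsProperEdgePathRay e r' →
    ProperlyHomotopic r r'

end Semistability

/-! ### The 2-complex `Γ(G, S, R)` -/

section Complex

variable {G ι : Type*} [Group G]

/-- The closed unit disc. -/
abbrev UnitDisc : Type := Metric.closedBall (0 : ℂ) 1

/-- The boundary point of the disc at angle `2πθ`. -/
def UnitDisc.bdry (θ : ℝ) : UnitDisc :=
  ⟨(Circle.exp (2 * Real.pi * θ) : ℂ), mem_closedBall_zero_iff.2 (Circle.norm_coe _).le⟩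

variable (G) in
/-- Cells of the complex: a vertex for each `g : G`, an edge labelled `i` starting at each `g`,
and a 2-cell for each `g` and each relator `r ∈ R`. -/
inductive CayleyCell (R : Set (FreeGroup ι)) : Type _
  | vertex (g : G) : CayleyCell R
  | edge (g : G) (i : ι) : CayleyCell R
  | face (g : G) (r : R) : CayleyCell R

/-- The closed model of a cell: a point, the unit interval, or the closed unit disc. -/
def CayleyCell.Model {R : Set (FreeGroup ι)} : CayleyCell G R → Type
  | .vertex _ => Unit
  | .edge _ _ => I
  | .face _ _ => UnitDisc

instance {R : Set (FreeGroup ι)} (c : CayleyCell G R) : TopologicalSpace c.Model :=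
  match c with
  | .vertex _ => inferInstanceAs (TopologicalSpace Unit)
  | .edge _ _ => inferInstanceAs (TopologicalSpace I)
  | .face _ _ => inferInstanceAs (TopologicalSpace UnitDisc)

variable (G) in
/-- The disjoint union of all closed cells. -/
abbrev CayleyCells (R : Set (FreeGroup ι)) : Type _ := Σ c : CayleyCell G R, c.Model

namespace CayleyCells

variable {R : Set (FreeGroup ι)}

/-- The vertex `g`. -/
def vertexPt (g : G) : CayleyCells G R := ⟨.vertex g, ()⟩

/-- The point at time `t` on the edge labelled `i` starting at `g`. -/
def edgePt (g : G) (i : ι) (t : I) : CayleyCells G R := ⟨.edge g i, t⟩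

/-- The point `z` of the 2-cell at `g` with label `r`. -/
def facePt (g : G) (r : R) (z : UnitDisc) : CayleyCells G R := ⟨.face g r, z⟩

/-- The point at time `t` on the edge that is traversed by reading the letter `l` from the
vertex `h`: the letter `(i, true)` stands for the generator `i` and follows the edge from `h` to
`h * s i`; the letter `(i, false)` stands for its inverse and follows backwards the edge from
`h * (s i)⁻¹` to `h`. -/
def letterPt (s : ι → G) (h : G) (l : ι × Bool) (t : I) : CayleyCells G R :=
  if l.2 then edgePt h l.1 t else edgePt (h * (s l.1)⁻¹) l.1 (unitInterval.symm t)

end CayleyCells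

open CayleyCells

open Classical in
/-- The gluing of the closed cells. The edge labelled `i` at `g` runs from `g` to `g * s i`.
The boundary circle of the 2-cell at `g` with label `r` is cut into as many equal arcs as the
reduced word of `r` has letters, and these are glued in turn to the edges of the edge path that
starts at `g` and has this word as its label (for the empty word, the whole circle is glued to
the vertex `g`). -/
inductive CayleyGlue (s : ι → G) (R : Set (FreeGroup ι)) :
    CayleyCells G R → CayleyCells G R → Prop
  | source (g : G) (i : ι) : CayleyGlue s R (edgePt g i 0) (vertexPt g)
  | target (g : G) (i : ι) : CayleyGlue s R (edgePt g i 1) (vertexPt (g * s i))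
  | side (g : G) (r : R) (j : ℕ) (hj : j < r.1.toWord.length) (t : I) :
      CayleyGlue s R
        (facePt g r (UnitDisc.bdry (((j : ℝ) + (t : ℝ)) / (r.1.toWord.length : ℝ))))
        (letterPt s (g * FreeGroup.lift s (FreeGroup.mk (r.1.toWord.take j)))
          r.1.toWord[j] t)
  | trivial (g : G) (r : R) (hr : r.1.toWord = []) (θ : ℝ) :
      CayleyGlue s R (facePt g r (UnitDisc.bdry θ)) (vertexPt g)

/-- The 2-complex `Γ(G, S, R)`, for a family `s` of generators of `G` and a set `R` of relations
between them (elements of the kernel of the map from the free group to `G`): the Cayley graph of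
`G` with a 2-cell attached at each vertex along each `r ∈ R`, with the quotient topology. -/
def CayleyComplex (s : ι → G) (R : Set (FreeGroup ι)) : Type _ := Quot (CayleyGlue s R)

instance (s : ι → G) (R : Set (FreeGroup ι)) : TopologicalSpace (CayleyComplex s R) :=
  inferInstanceAs (TopologicalSpace (Quot (CayleyGlue s R)))

/-- The characteristic map of the edge of `Γ(G, S, R)` labelled `k.2` that starts at `k.1`. -/
def CayleyComplex.edge (s : ι → G) (R : Set (FreeGroup ι)) (k : G × ι) (t : I) :
    CayleyComplex s R :=
  Quot.mk _ (edgePt k.1 k.2 t)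

end Complex

/-- Semistability at infinity of a finitely generated (one-ended) group `G`: for some finite
generating set `S` and some finite set `R` of `S`-relations, the complex `Γ(G, S, R)` is
semistable at infinity. -/
def Group.SemistableAtInfinity (G : Type*) [Group G] : Prop :=
  ∃ (S : Set G) (R : Set (FreeGroup S)),
    S.Finite ∧ Subgroup.closure S = ⊤ ∧
    R.Finite ∧ (∀ r ∈ R, FreeGroup.lift (Subtype.val : S → G) r = 1) ∧
    _root_.SemistableAtInfinity (CayleyComplex.edge (Subtype.val : S → G) R)

/-! ### The Lamplighter group -/

/-- The two generators `a`, `x` of the Lamplighter group. -/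
inductive LampGen : Type
  | a : LampGen
  | x : LampGen

open LampGen in
/-- The relators `a²` and `[a, x⁻ᵏ a xᵏ]`, `k ∈ ℤ`. -/
def lamplighterRels : Set (FreeGroup LampGen) :=
  {FreeGroup.of a ^ 2} ∪
    Set.range fun k : ℤ =>
      ⁅FreeGroup.of a, FreeGroup.of x ^ (-k) * FreeGroup.of a * FreeGroup.of x ^ k⁆

/-- The Lamplighter group `L = ⟨a, x : a², [a, x⁻ᵏ a xᵏ] (k ∈ ℤ)⟩`. -/
abbrev Lamplighter : Type := PresentedGroup lamplighterRels

/-- The generating family `{a, x}` of the Lamplighter group. -/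
def Lamplighter.gen : LampGen → Lamplighter := PresentedGroup.of

end

/-! The position of the lamplighter is a homomorphism `p` onto `ℤ` whose kernel is locally finite,
being generated by commuting involutions. This alone excludes semistability, for all finite
generating sets and finite sets of relations (`not_semistableAtInfinity_of_locallyFinite_ker`).

Let `x` have height 1. While `g` stays near level 0, right multiplication by a generator or a prefix
of a relator changes `g x^(-p g)` by one of finitely many elements of the kernel, and these generate
a finite subgroup. Let `E` consist of the `g` with `g x^(-p g)` in that subgroup. Near the level `E`
is finite, and a 2-cell based there has its corners all in `E` or all outside. Translates of `E` do
the same at other levels. So the upward crossings of the level inside `E` form a 1-cocycle of finite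
support, realised by a circle-valued map `F` vanishing off a compact set (`exists_circle_map`).

Take a generator `a` of positive height (after changing the sign of `p` if needed), the upward ray
of its positive powers and the downward ray of its negative powers. Given a proper homotopy `H`
between them, choose the level above the track `H(0, ·)`. Then `F ∘ H` vanishes on that track and,
by properness, on `{T} × I` for some large `T`. A real lift of `F ∘ H` is therefore constant on
these two sides of `[0, T] × I`, is also unchanged along the downward ray, yet grows by 1 along the
upward ray: a contradiction (`not_semistableAtInfinity_of_height`).

The topology of the complex is handled through functions: those on the 1-skeleton extend over the
2-cells by Tietze (`exists_extension`). This gives a continuous height and the Hausdorff property,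
hence properness of the two rays. -/

noncomputable section

/-! ### Functions on the complex, cell by cell. -/

section CellFunctions

variable {G ι : Type*} [Group G]

open Classical in
/-- The element of `G` represented by the first `j` letters of the reduced word of `r`. -/
def prefixElt (s : ι → G) (r : FreeGroup ι) (j : ℕ) : G :=
  FreeGroup.lift s (FreeGroup.mk (r.toWord.take j))

/-- The element of `G` represented by a letter. -/
def letterElt (s : ι → G) (l : ι × Bool) : G := if l.2 then s l.1 else (s l.1)⁻¹

/-- The values, along the edge traversed by reading the letter `l` from `h`, of a function `e` on
the edges. -/
def letterVal {T : Type*} (s : ι → G) (e : G → ι → I → T) (h : G) (l : ι × Bool) (t : I) : T :=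
  if l.2 then e h l.1 t else e (h * (s l.1)⁻¹) l.1 (unitInterval.symm t)

open Classical in
lemma prefixElt_zero (s : ι → G) (r : FreeGroup ι) : prefixElt s r 0 = 1 := by
  simp [prefixElt, ← FreeGroup.one_eq_mk]

open Classical in
lemma prefixElt_length (s : ι → G) (r : FreeGroup ι) :
    prefixElt s r r.toWord.length = FreeGroup.lift s r := by
  simp [prefixElt, FreeGroup.mk_toWord]

open Classical in
lemma prefixElt_succ (s : ι → G) (r : FreeGroup ι) (j : ℕ) (hj : j < r.toWord.length) :
    prefixElt s r (j + 1) = prefixElt s r j * letterElt s r.toWord[j] := by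
  unfold prefixElt letterElt
  rw [List.take_succ_eq_append_getElem hj, ← FreeGroup.mul_mk, map_mul]
  congr 1
  rcases r.toWord[j] with ⟨i, b⟩
  cases b <;> simp [FreeGroup.lift_mk]

section letterVal

variable {T : Type*} {s : ι → G} {e : G → ι → I → T} {v : G → T}

lemma letterVal_zero (h0 : ∀ g i, e g i 0 = v g) (h1 : ∀ g i, e g i 1 = v (g * s i))
    (h : G) (l : ι × Bool) : letterVal s e h l 0 = v h := by
  unfold letterVal
  split_ifs <;> simp [h0, h1]

lemma letterVal_one (h0 : ∀ g i, e g i 0 = v g) (h1 : ∀ g i, e g i 1 = v (g * s i))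
    (h : G) (l : ι × Bool) : letterVal s e h l 1 = v (h * letterElt s l) := by
  unfold letterVal letterElt
  split_ifs <;> simp [h0, h1]

lemma continuous_letterVal [TopologicalSpace T] (he : ∀ g i, Continuous (e g i))
    (h : G) (l : ι × Bool) : Continuous (letterVal s e h l) := by
  unfold letterVal
  split_ifs
  · exact he _ _
  · exact (he _ _).comp unitInterval.continuous_symm

end letterVal

namespace CayleyComplex

variable {s : ι → G} {R : Set (FreeGroup ι)}

variable (s R) in
/-- The vertex `g` of the complex. -/
def vertex (g : G) : CayleyComplex s R := Quot.mk _ (CayleyCells.vertexPt g)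

variable (s R) in
/-- The characteristic map of the 2-cell at `g` with label `r`. -/
def face (g : G) (r : R) (z : UnitDisc) : CayleyComplex s R := Quot.mk _ (CayleyCells.facePt g r z)

lemma edge_zero (g : G) (i : ι) : edge s R (g, i) 0 = vertex s R g := Quot.sound (.source g i)

lemma edge_one (g : G) (i : ι) : edge s R (g, i) 1 = vertex s R (g * s i) :=
  Quot.sound (.target g i)

lemma continuous_edge (k : G × ι) : Continuous (edge s R k) :=
  continuous_quot_mk.comp
    (continuous_sigmaMk : Continuous (Sigma.mk (CayleyCell.edge k.1 k.2) : _ → CayleyCells G R))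

lemma continuous_face (g : G) (r : R) : Continuous (face s R g r) :=
  continuous_quot_mk.comp
    (continuous_sigmaMk : Continuous (Sigma.mk (CayleyCell.face g r) : _ → CayleyCells G R))

lemma letterVal_edge (h : G) (l : ι × Bool) (t : I) :
    letterVal s (fun g i => edge s R (g, i)) h l t = Quot.mk _ (CayleyCells.letterPt s h l t) := by
  unfold letterVal CayleyCells.letterPt
  split_ifs <;> rfl

open Classical in
lemma face_bdry (g : G) (r : R) (j : ℕ) (hj : j < r.1.toWord.length) (t : I) :
    face s R g r (UnitDisc.bdry (((j : ℝ) + (t : ℝ)) / (r.1.toWord.length : ℝ))) =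
      letterVal s (fun g i => edge s R (g, i)) (g * prefixElt s r.1 j) r.1.toWord[j] t := by
  rw [letterVal_edge]
  exact Quot.sound (.side g r j hj t)

open Classical in
lemma face_bdry_trivial (g : G) (r : R) (hr : r.1.toWord = []) (θ : ℝ) :
    face s R g r (UnitDisc.bdry θ) = vertex s R g := Quot.sound (.trivial g r hr θ)

@[elab_as_elim]
lemma ind {P : CayleyComplex s R → Prop} (hv : ∀ g, P (vertex s R g))
    (he : ∀ g i t, P (edge s R (g, i) t)) (hf : ∀ g r z, P (face s R g r z)) (x) : P x := by
  induction x using Quot.ind with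
  | mk a =>
    rcases a with ⟨_ | _ | _, m⟩
    · exact hv _
    · exact he _ _ m
    · exact hf _ _ m

open Classical in
/-- Functions on the closed cells that agree along the gluing define a function on the complex. -/
theorem exists_glue {T : Type*} [TopologicalSpace T] (v : G → T) (e : G → ι → I → T)
    (w : G → R → UnitDisc → T) (he : ∀ g i, Continuous (e g i)) (hw : ∀ g r, Continuous (w g r))
    (h0 : ∀ g i, e g i 0 = v g) (h1 : ∀ g i, e g i 1 = v (g * s i))
    (hside : ∀ g (r : R) j (hj : j < r.1.toWord.length) (t : I),
      w g r (UnitDisc.bdry (((j : ℝ) + (t : ℝ)) / (r.1.toWord.length : ℝ))) =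
        letterVal s e (g * prefixElt s r.1 j) r.1.toWord[j] t)
    (htriv : ∀ g (r : R), r.1.toWord = [] → ∀ θ, w g r (UnitDisc.bdry θ) = v g) :
    ∃ F : C(CayleyComplex s R, T), (∀ g, F (vertex s R g) = v g) ∧
      (∀ g i t, F (edge s R (g, i) t) = e g i t) ∧ ∀ g r z, F (face s R g r z) = w g r z := by
  let f : CayleyCells G R → T := fun x => match x with
    | ⟨.vertex g, _⟩ => v g
    | ⟨.edge g i, t⟩ => e g i t
    | ⟨.face g r, z⟩ => w g r z
  have hf : Continuous f := by
    refine continuous_sigma fun c => ?_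
    rcases c with g | ⟨g, i⟩ | ⟨g, r⟩
    · exact continuous_const
    · exact he g i
    · exact hw g r
  have hcompat : ∀ a b, CayleyGlue s R a b → f a = f b := by
    rintro _ _ (⟨g, i⟩ | ⟨g, i⟩ | ⟨g, r, j, hj, t⟩ | ⟨g, r, hr, θ⟩)
    · exact h0 g i
    · exact h1 g i
    · refine (hside g r j hj t).trans ?_
      unfold letterVal CayleyCells.letterPt prefixElt
      split_ifs <;> rfl
    · exact htriv g r hr θ
  exact ⟨⟨Quot.lift f hcompat, continuous_quot_lift hcompat hf⟩, fun _ => rfl,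
    fun _ _ _ => rfl, fun _ _ _ => rfl⟩

end CayleyComplex

lemma UnitDisc.continuous_bdry : Continuous UnitDisc.bdry := by
  unfold UnitDisc.bdry
  fun_prop

lemma UnitDisc.bdry_eq_iff {θ θ' : ℝ} : bdry θ = bdry θ' ↔ ∃ n : ℤ, θ = θ' + n := by
  unfold bdry
  rw [Subtype.mk.injEq, Circle.coe_inj, Circle.exp_eq_exp]
  have := Real.pi_pos
  refine exists_congr fun n => ⟨fun h => ?_, fun h => by rw [h]; ring⟩
  have h2 : (2 * Real.pi) * θ = (2 * Real.pi) * (θ' + n) := by linear_combination h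
  exact mul_left_cancel₀ (by positivity) h2

open Classical in
/-- A function on the 1-skeleton extends over each 2-cell, with values in any prescribed interval
that contains the values on the boundary. -/
theorem exists_disc_extension {s : ι → G} {r : FreeGroup ι} (hr : FreeGroup.lift s r = 1)
    (v : G → ℝ) (e : G → ι → I → ℝ) (he : ∀ g i, Continuous (e g i))
    (h0 : ∀ g i, e g i 0 = v g) (h1 : ∀ g i, e g i 1 = v (g * s i)) (g : G)
    (A : Set ℝ) [A.OrdConnected] (hv : v g ∈ A)
    (hA : ∀ j (hj : j < r.toWord.length) (t : I),
      letterVal s e (g * prefixElt s r j) r.toWord[j] t ∈ A) :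
    ∃ w : C(UnitDisc, ℝ), (∀ z, w z ∈ A) ∧
      (∀ j (hj : j < r.toWord.length) (t : I),
        w (UnitDisc.bdry (((j : ℝ) + (t : ℝ)) / (r.toWord.length : ℝ))) =
          letterVal s e (g * prefixElt s r j) r.toWord[j] t) ∧
      (r.toWord = [] → ∀ θ, w (UnitDisc.bdry θ) = v g) := by
  rcases Nat.eq_zero_or_pos r.toWord.length with hl | hl
  · exact ⟨ContinuousMap.const _ (v g), fun _ => hv, fun j hj => by omega, fun _ _ => rfl⟩
  set ℓ := r.toWord.length with hℓ
  have hℓ0 : (0 : ℝ) < ℓ := by exact_mod_cast hl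
  let q : (Σ _ : Fin ℓ, I) → UnitDisc := fun x => UnitDisc.bdry (((x.1 : ℕ) + (x.2 : ℝ)) / (ℓ : ℝ))
  have hq : Continuous q := by
    refine continuous_sigma fun j => UnitDisc.continuous_bdry.comp ?_
    fun_prop
  let val : (Σ _ : Fin ℓ, I) → ℝ := fun x =>
    letterVal s e (g * prefixElt s r x.1) (r.toWord[(x.1 : ℕ)]'x.1.2) x.2
  have hval : Continuous val := continuous_sigma fun j =>
    continuous_letterVal (s := s) he (g * prefixElt s r j) (r.toWord[(j : ℕ)]'j.2)
  -- Both parameters lie in `[0, ℓ]`, so `|n| ≤ 1`. Distinct representations of one boundary point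
  -- are thus the common end of two consecutive arcs, or the end of the last arc and the start of
  -- the first; in the latter case the values agree because `r` is a relation.
  have key : ∀ x y : Σ _ : Fin ℓ, I, ∀ n : ℤ, ((x.1 : ℕ) : ℝ) + x.2 = (y.1 : ℕ) + y.2 + n * ℓ →
      val x = val y := by
    have hval0 : ∀ j : Fin ℓ, val ⟨j, 0⟩ = v (g * prefixElt s r j) := fun j =>
      letterVal_zero h0 h1 _ _
    have hval1 : ∀ j : Fin ℓ, val ⟨j, 1⟩ = v (g * prefixElt s r (j + 1)) := fun j =>
      (letterVal_one h0 h1 _ _).trans (by rw [prefixElt_succ s r j j.2, mul_assoc])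
    have next : ∀ (j j' : Fin ℓ) (t t' : I), (j : ℕ) + 1 = j' → (t : ℝ) = 1 → (t' : ℝ) = 0 →
        val ⟨j, t⟩ = val ⟨j', t'⟩ := by
      intro j j' t t' hj ht ht'
      obtain rfl : t = 1 := Subtype.ext ht
      obtain rfl : t' = 0 := Subtype.ext ht'
      rw [hval0, hval1, hj]
    have wrap : ∀ (j j' : Fin ℓ) (t t' : I), (j : ℕ) + 1 = ℓ → (j' : ℕ) = 0 → (t : ℝ) = 1 →
        (t' : ℝ) = 0 → val ⟨j, t⟩ = val ⟨j', t'⟩ := by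
      intro j j' t t' hj hj' ht ht'
      obtain rfl : t = 1 := Subtype.ext ht
      obtain rfl : t' = 0 := Subtype.ext ht'
      rw [hval0, hval1, hj, hj', hℓ, prefixElt_length, hr, prefixElt_zero]
    rintro ⟨j, t⟩ ⟨j', t'⟩ n h
    have ht0 := t.2.1
    have ht1 := t.2.2
    have ht0' := t'.2.1
    have ht1' := t'.2.2
    have hj : ((j : ℕ) : ℝ) + 1 ≤ ℓ := by exact_mod_cast j.2
    have hj' : ((j' : ℕ) : ℝ) + 1 ≤ ℓ := by exact_mod_cast j'.2
    have hj0 : (0 : ℝ) ≤ (j : ℕ) := Nat.cast_nonneg _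
    have hj0' : (0 : ℝ) ≤ (j' : ℕ) := Nat.cast_nonneg _
    dsimp only at h
    have hn1 : n < 2 := by
      by_contra! hn
      have : (2 : ℝ) ≤ n := by exact_mod_cast hn
      nlinarith
    have hn2 : -2 < n := by
      by_contra! hn
      have : (n : ℝ) ≤ -2 := by exact_mod_cast hn
      nlinarith
    obtain rfl | rfl | rfl : n = -1 ∨ n = 0 ∨ n = 1 := by omega
    · push_cast at h
      refine (wrap j' j t' t ?_ ?_ (by linarith) (by linarith)).symm
      · exact_mod_cast (by linarith : ((j' : ℕ) : ℝ) + 1 = ℓ)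
      · exact_mod_cast (by linarith : ((j : ℕ) : ℝ) = 0)
    · rcases lt_trichotomy (j : ℕ) j' with hlt | heq | hlt
      · have : ((j : ℕ) : ℝ) + 1 ≤ (j' : ℕ) := by exact_mod_cast hlt
        push_cast at h
        refine next j j' t t' ?_ (by linarith) (by linarith)
        exact_mod_cast (by linarith : ((j : ℕ) : ℝ) + 1 = (j' : ℕ))
      · obtain rfl : j = j' := Fin.ext heq
        obtain rfl : t = t' := Subtype.ext (by push_cast at h; linarith)
        rfl
      · have : ((j' : ℕ) : ℝ) + 1 ≤ (j : ℕ) := by exact_mod_cast hlt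
        push_cast at h
        refine (next j' j t' t ?_ (by linarith) (by linarith)).symm
        exact_mod_cast (by linarith : ((j' : ℕ) : ℝ) + 1 = (j : ℕ))
    · push_cast at h
      refine wrap j j' t t' ?_ ?_ (by linarith) (by linarith)
      · exact_mod_cast (by linarith : ((j : ℕ) : ℝ) + 1 = ℓ)
      · exact_mod_cast (by linarith : ((j' : ℕ) : ℝ) = 0)
  have hfib : ∀ x y, q x = q y → val x = val y := by
    intro x y hxy
    obtain ⟨n, hn⟩ := UnitDisc.bdry_eq_iff.1 hxy
    refine key x y n ?_
    field_simp at hn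
    linarith
  let q' : C((Σ _ : Fin ℓ, I), Set.range q) := ⟨Set.rangeFactorization q, hq.subtype_mk _⟩
  -- A continuous map from a compact space to a Hausdorff one is closed, so the values on the arcs
  -- descend to the boundary circle; Tietze with values in `A` then fills the disc.
  have hquot : Topology.IsQuotientMap q' :=
    q'.continuous.isClosedMap.isQuotientMap q'.continuous Set.rangeFactorization_surjective
  have hfac : Function.FactorsThrough (⟨val, hval⟩ : C((Σ _ : Fin ℓ, I), ℝ)) q' := fun x y hxy =>
    hfib x y (Subtype.ext_iff.1 hxy : (q' x : UnitDisc) = q' y)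
  let φ : C(Set.range q, ℝ) := hquot.lift ⟨val, hval⟩ hfac
  have hφ : ∀ x, φ (q' x) = val x := fun x =>
    DFunLike.congr_fun (hquot.lift_comp ⟨val, hval⟩ hfac) x
  have hcl : IsClosed (Set.range q) := (isCompact_range hq).isClosed
  obtain ⟨w, hwA, hw⟩ := φ.exists_restrict_eq_forall_mem_of_closed (t := A) (fun y => by
    obtain ⟨x, rfl⟩ := Set.rangeFactorization_surjective y
    exact (hφ x).symm ▸ hA _ _ _) ⟨_, hv⟩ hcl
  refine ⟨w, hwA, fun j hj t => ?_, fun h => by simp [h] at hℓ; omega⟩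
  have := hφ ⟨⟨j, hj⟩, t⟩
  rw [← hw] at this
  exact this

end CellFunctions

/-! ### Continuous functions separate points; the complex is Hausdorff. -/

section Separation

variable {G ι : Type*} [Group G] {s : ι → G} {R : Set (FreeGroup ι)}

namespace CayleyComplex

open Classical in
/-- A continuous function on the 1-skeleton extends to the whole complex, with values on each
2-cell in any prescribed interval that contains the values on its boundary. -/
theorem exists_extension (hR : ∀ r ∈ R, FreeGroup.lift s r = 1)
    (v : G → ℝ) (e : G → ι → I → ℝ) (he : ∀ g i, Continuous (e g i))
    (h0 : ∀ g i, e g i 0 = v g) (h1 : ∀ g i, e g i 1 = v (g * s i))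
    (A : G → R → Set ℝ) [∀ g r, (A g r).OrdConnected] (hv : ∀ g r, v g ∈ A g r)
    (hA : ∀ g (r : R) j (hj : j < r.1.toWord.length) (t : I),
      letterVal s e (g * prefixElt s r.1 j) r.1.toWord[j] t ∈ A g r) :
    ∃ F : C(CayleyComplex s R, ℝ), (∀ g, F (vertex s R g) = v g) ∧
      (∀ g i t, F (edge s R (g, i) t) = e g i t) ∧ ∀ g r z, F (face s R g r z) ∈ A g r := by
  choose w hwA hw hw' using fun (g : G) (r : R) =>
    exists_disc_extension (hR r.1 r.2) v e he h0 h1 g (A g r) (hv g r) (hA g r)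
  obtain ⟨F, hF0, hF1, hF2⟩ := exists_glue (s := s) (R := R) v e (fun g r => w g r) he
    (fun g r => (w g r).continuous) h0 h1 hw hw'
  exact ⟨F, hF0, hF1, fun g r z => hF2 g r z ▸ hwA g r z⟩

/-- The linear interpolation of a function on the vertices along the edges. -/
def linEdge (s : ι → G) (v : G → ℝ) (g : G) (i : ι) (t : I) : ℝ :=
  v g + t * (v (g * s i) - v g)

lemma continuous_linEdge (v : G → ℝ) (g : G) (i : ι) : Continuous (linEdge s v g i) := by
  unfold linEdge
  fun_prop

lemma linEdge_zero (v : G → ℝ) (g : G) (i : ι) : linEdge s v g i 0 = v g := by simp [linEdge]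

lemma linEdge_one (v : G → ℝ) (g : G) (i : ι) : linEdge s v g i 1 = v (g * s i) := by
  simp [linEdge]

open Classical in
lemma exists_apply_vertex (hR : ∀ r ∈ R, FreeGroup.lift s r = 1) (v : G → ℝ) :
    ∃ F : C(CayleyComplex s R, ℝ), ∀ g, F (vertex s R g) = v g := by
  obtain ⟨F, hF, -⟩ := exists_extension hR v (linEdge s v) (continuous_linEdge v) (linEdge_zero v)
    (linEdge_one v) (fun _ _ => Set.univ) (fun _ _ => trivial) (fun _ _ _ _ _ => trivial)
  exact ⟨F, hF⟩

open Classical in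
/-- A bump function supported on a single open edge. -/
lemma exists_edge_bump (hR : ∀ r ∈ R, FreeGroup.lift s r = 1) (k : G × ι) (f : I → ℝ)
    (hf : Continuous f) (hf0 : f 0 = 0) (hf1 : f 1 = 0) :
    ∃ F : C(CayleyComplex s R, ℝ), (∀ g, F (vertex s R g) = 0) ∧
      ∀ k' t, F (edge s R k' t) = if k' = k then f t else 0 := by
  obtain ⟨F, hF0, hF1, -⟩ := exists_extension hR (fun _ => 0)
    (fun g i t => if (g, i) = k then f t else 0) (fun g i => by split_ifs <;> fun_prop)
    (fun g i => by simp [hf0]) (fun g i => by simp [hf1])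
    (fun _ _ => Set.univ) (fun _ _ => trivial) (fun _ _ _ _ _ => trivial)
  exact ⟨F, hF0, fun k' t => hF1 k'.1 k'.2 t⟩

open Classical in
/-- A bump function supported on a single open 2-cell. -/
lemma exists_face_bump (g : G) (r : R) (f : UnitDisc → ℝ) (hf : Continuous f)
    (hf0 : ∀ θ, f (UnitDisc.bdry θ) = 0) :
    ∃ F : C(CayleyComplex s R, ℝ), (∀ g, F (vertex s R g) = 0) ∧
      (∀ k t, F (edge s R k t) = 0) ∧
      ∀ g' r' z, F (face s R g' r' z) = if g' = g ∧ r' = r then f z else 0 := by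
  obtain ⟨F, hF0, hF1, hF2⟩ := exists_glue (s := s) (R := R) (fun _ => (0 : ℝ)) (fun _ _ _ => 0)
    (fun g' r' z => if g' = g ∧ r' = r then f z else 0) (fun _ _ => continuous_const)
    (fun g' r' => by split_ifs <;> fun_prop) (fun _ _ => rfl) (fun _ _ => rfl)
    (fun g' r' j hj t => by simp [hf0, letterVal]) (fun g' r' hr θ => by simp [hf0])
  exact ⟨F, hF0, fun k t => hF1 k.1 k.2 t, hF2⟩

end CayleyComplex

lemma UnitDisc.norm_bdry (θ : ℝ) : ‖(bdry θ : ℂ)‖ = 1 := Circle.norm_coe _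

lemma UnitDisc.exists_bdry (z : UnitDisc) (hz : ‖(z : ℂ)‖ = 1) :
    ∃ θ ∈ Set.Ico (0 : ℝ) 1, bdry θ = z := by
  have hz' : Circle.exp (Complex.arg z) = (z : ℂ) := by
    rw [Circle.coe_exp]
    simpa [hz] using Complex.norm_mul_exp_arg_mul_I (z : ℂ)
  refine ⟨Int.fract (Complex.arg z / (2 * Real.pi)), ⟨Int.fract_nonneg _, Int.fract_lt_one _⟩, ?_⟩
  have : bdry (Int.fract (Complex.arg z / (2 * Real.pi))) = bdry (Complex.arg z / (2 * Real.pi)) :=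
    bdry_eq_iff.2 ⟨-⌊Complex.arg z / (2 * Real.pi)⌋, by rw [Int.fract]; push_cast; ring⟩
  rw [this]
  refine Subtype.ext (Eq.trans ?_ hz')
  change ((Circle.exp (2 * Real.pi * (Complex.arg z / (2 * Real.pi))) : Circle) : ℂ) = _
  rw [mul_div_cancel₀ _ (by positivity)]

namespace CayleyComplex

open Classical in
/-- Each point of the complex is a vertex, an interior point of an edge, or an interior point of a
2-cell. -/
lemma cases_open_cell {P : CayleyComplex s R → Prop} (hv : ∀ g, P (vertex s R g))
    (he : ∀ k t, t ≠ 0 → t ≠ 1 → P (edge s R k t))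
    (hf : ∀ g r (z : UnitDisc), ‖(z : ℂ)‖ < 1 → P (face s R g r z)) (x) : P x := by
  have he' : ∀ k t, P (edge s R k t) := by
    rintro ⟨g, i⟩ t
    by_cases h0 : t = 0
    · rw [h0, edge_zero]; exact hv _
    by_cases h1 : t = 1
    · rw [h1, edge_one]; exact hv _
    exact he _ _ h0 h1
  refine ind hv (fun _ _ => he' _) (fun g r z => ?_) x
  rcases (mem_closedBall_zero_iff.1 z.2).lt_or_eq with h | h
  · exact hf g r z h
  obtain ⟨θ, ⟨hθ0, hθ1⟩, rfl⟩ := UnitDisc.exists_bdry z h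
  rcases Nat.eq_zero_or_pos r.1.toWord.length with hl | hl
  · rw [face_bdry_trivial g r (List.length_eq_zero_iff.1 hl)]
    exact hv _
  · have hl' : (0 : ℝ) < r.1.toWord.length := by exact_mod_cast hl
    set ℓ := r.1.toWord.length
    have hj : ⌊θ * ℓ⌋₊ < ℓ := by
      rw [Nat.floor_lt (by positivity)]
      nlinarith
    have hx : θ = ((⌊θ * ℓ⌋₊ : ℝ) + (θ * ℓ - ⌊θ * ℓ⌋₊)) / ℓ := by field_simp; ring
    have := face_bdry (s := s) g r _ hj ⟨θ * ℓ - ⌊θ * ℓ⌋₊,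
      sub_nonneg.2 (Nat.floor_le (by positivity)), by linarith [Nat.lt_floor_add_one (θ * ℓ)]⟩
    rw [hx, this]
    unfold letterVal
    split_ifs <;> exact he' _ _

open Classical in
/-- Continuous functions separate the points of the complex. -/
theorem exists_apply_ne (hR : ∀ r ∈ R, FreeGroup.lift s r = 1) {x y : CayleyComplex s R}
    (hxy : x ≠ y) : ∃ F : C(CayleyComplex s R, ℝ), F x ≠ F y := by
  have hface : ∀ g r (z : UnitDisc), ‖(z : ℂ)‖ < 1 → ∀ y : CayleyComplex s R,
      face s R g r z ≠ y → ∃ F : C(CayleyComplex s R, ℝ), F (face s R g r z) ≠ F y := by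
    intro g r z hz y hy
    obtain ⟨F, hF0, hF1, hF2⟩ := exists_face_bump (s := s) g r (fun z => 1 - ‖(z : ℂ)‖)
      (by fun_prop) (fun θ => by simp [UnitDisc.norm_bdry])
    have hz' : F (face s R g r z) ≠ 0 := by simp [hF2]; linarith
    induction y using ind with
    | hv g' => exact ⟨F, by rwa [hF0]⟩
    | he g' i t => exact ⟨F, by rwa [hF1]⟩
    | hf g' r' z' =>
      by_cases h : g' = g ∧ r' = r
      · obtain ⟨rfl, rfl⟩ := h
        -- The first bump may agree at two points of the same cell; the extra factor vanishes
        -- exactly at `z'`.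
        obtain ⟨F', -, -, hF'⟩ := exists_face_bump (s := s) g' r'
          (fun w => (1 - ‖(w : ℂ)‖) * ‖(w : ℂ) - z'‖) (by fun_prop)
          (fun θ => by simp [UnitDisc.norm_bdry])
        refine ⟨F', ?_⟩
        have : z ≠ z' := fun h => hy (by rw [h])
        simp only [hF', and_self, if_true, sub_self, norm_zero, mul_zero]
        exact mul_ne_zero (by linarith)
          (norm_ne_zero_iff.2 (sub_ne_zero.2 (Subtype.coe_ne_coe.2 this)))
      · exact ⟨F, by rw [hF2 g' r' z', if_neg h]; exact hz'⟩
  have hedge : ∀ k t, t ≠ 0 → t ≠ 1 → ∀ y : CayleyComplex s R,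
      edge s R k t ≠ y → ∃ F : C(CayleyComplex s R, ℝ), F (edge s R k t) ≠ F y := by
    intro k t ht0 ht1 y hy
    have ht0' : (t : ℝ) ≠ 0 := fun h => ht0 (Subtype.ext h)
    have ht1' : 1 - (t : ℝ) ≠ 0 := fun h => ht1 (Subtype.ext (sub_eq_zero.1 h).symm)
    obtain ⟨F, hF0, hF1⟩ := exists_edge_bump hR k (fun t : I => (t : ℝ) * (1 - t))
      (by fun_prop) (by simp) (by simp)
    have hz' : F (edge s R k t) ≠ 0 := by simp [hF1, ht0', ht1']
    induction y using cases_open_cell with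
    | hv g' => exact ⟨F, by rwa [hF0]⟩
    | hf g' r' z' hz =>
      obtain ⟨F, hF⟩ := hface g' r' z' hz _ hy.symm
      exact ⟨F, hF.symm⟩
    | he k' t' _ _ =>
      by_cases h : k' = k
      · subst h
        obtain ⟨F', -, hF'⟩ := exists_edge_bump hR k'
          (fun u : I => (u : ℝ) * (1 - u) * (u - t')) (by fun_prop) (by simp) (by simp)
        refine ⟨F', ?_⟩
        have : t ≠ t' := fun h => hy (by rw [h])
        simp only [hF', if_true, sub_self, mul_zero]
        exact mul_ne_zero (mul_ne_zero ht0' ht1') (sub_ne_zero.2 (Subtype.coe_ne_coe.2 this))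
      · exact ⟨F, by rw [hF1 k' t', if_neg h]; exact hz'⟩
  induction x using cases_open_cell with
  | hf g r z hz => exact hface g r z hz y hxy
  | he k t h0 h1 => exact hedge k t h0 h1 y hxy
  | hv g =>
    induction y using cases_open_cell with
    | hf g' r z hz =>
      obtain ⟨F, hF⟩ := hface g' r z hz _ hxy.symm
      exact ⟨F, hF.symm⟩
    | he k t h0 h1 =>
      obtain ⟨F, hF⟩ := hedge k t h0 h1 _ hxy.symm
      exact ⟨F, hF.symm⟩
    | hv g' =>
      obtain ⟨F, hF⟩ := exists_apply_vertex hR (fun h => if h = g then (1 : ℝ) else 0)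
      refine ⟨F, ?_⟩
      have : g' ≠ g := fun h => hxy (by rw [h])
      simp [hF, this]

/-- Needed to deduce that a ray is proper from properness of its composite with the height. -/
theorem t2Space (hR : ∀ r ∈ R, FreeGroup.lift s r = 1) : T2Space (CayleyComplex s R) := by
  refine ⟨fun x y hxy => ?_⟩
  obtain ⟨F, hF⟩ := exists_apply_ne hR hxy
  exact separated_by_continuous F.continuous hF

end CayleyComplex

end Separation

/-! ### Concatenation of paths into a ray. -/

section Rays

/-- Paths that fit together define a ray. -/
theorem exists_ray {X : Type*} [TopologicalSpace X] (γ : ℕ → I → X) (hγ : ∀ n, Continuous (γ n))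
    (h : ∀ n, γ n 1 = γ (n + 1) 0) :
    ∃ r : ℝ≥0 → X, Continuous r ∧ ∀ (n : ℕ) (t : I), r (n + unitInterval.toNNReal t) = γ n t := by
  let r : ℝ≥0 → X := fun x => γ ⌊x⌋₊ (Set.projIcc 0 1 zero_le_one ((x : ℝ) - ⌊x⌋₊))
  have hr : ∀ n : ℕ, ∀ x ∈ Set.Icc (n : ℝ≥0) (n + 1),
      r x = γ n (Set.projIcc 0 1 zero_le_one ((x : ℝ) - n)) := by
    rintro n x ⟨h1, h2⟩
    rcases h2.lt_or_eq with h2 | rfl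
    · have : ⌊x⌋₊ = n := (Nat.floor_eq_iff (zero_le)).2 ⟨h1, h2⟩
      simp only [r, this]
    · have : ⌊(n : ℝ≥0) + 1⌋₊ = n + 1 := by exact_mod_cast Nat.floor_natCast (R := ℝ≥0) (n + 1)
      simp only [r, this]
      simpa using (h n).symm
  refine ⟨r, ?_, fun n t => ?_⟩
  · have hlf : LocallyFinite fun n : ℕ => Set.Icc (n : ℝ≥0) (n + 1) := by
      intro x
      refine ⟨Set.Iio (x + 1), Iio_mem_nhds (by simp), (Set.finite_Iio (⌊x⌋₊ + 2)).subset ?_⟩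
      rintro n ⟨y, ⟨h1, -⟩, h2⟩
      have : (n : ℝ≥0) < (⌊x⌋₊ + 2 : ℕ) := by
        refine (h1.trans_lt h2).trans ?_
        have := Nat.lt_floor_add_one x
        push_cast
        calc x + 1 < ⌊x⌋₊ + 1 + 1 := by gcongr
          _ = _ := by ring
      exact_mod_cast this
    refine hlf.continuous (Set.eq_univ_of_forall fun x => Set.mem_iUnion.2 ⟨⌊x⌋₊,
      Nat.floor_le (zero_le), (Nat.lt_floor_add_one x).le⟩) (fun n => isClosed_Icc) fun n => ?_
    refine ContinuousOn.congr (f := fun x : ℝ≥0 =>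
      γ n (Set.projIcc 0 1 zero_le_one ((x : ℝ) - n))) ?_ (hr n)
    exact ((hγ n).comp (continuous_projIcc.comp (by fun_prop))).continuousOn
  · rw [hr n _ ⟨by simp, by gcongr; exact t.2.2⟩]
    congr 1
    rw [← Set.projIcc_val zero_le_one t]
    congr 1
    simp

end Rays

/-! ### Real lifts of circle-valued maps. -/

section Winding

/-- Uniqueness of lifts through `ℝ → ℝ/ℤ`: `f` and the constant `f b` both lift the zero map. -/
lemma eq_of_coe_addCircle_eq_zero {A : Type*} [TopologicalSpace A] [PreconnectedSpace A]
    {f : A → ℝ} (hf : Continuous f) (h : ∀ a, (f a : UnitAddCircle) = 0) (a b : A) :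
    f a = f b := by
  have := (AddCircle.isCoveringMap_coe (1 : ℝ)).eq_of_comp_eq hf
    (continuous_const (y := f b)) (by funext x; exact (h x).trans (h b).symm) b rfl
  exact congrFun this a

/-- Reads off the change of a lift along an edge: `f t - t c` lifts zero, hence is constant. -/
lemma eq_add_of_coe_addCircle_eq {f : I → ℝ} (hf : Continuous f) (c : ℝ)
    (h : ∀ t, (f t : UnitAddCircle) = ((t * c : ℝ) : UnitAddCircle)) : f 1 = f 0 + c := by
  have := eq_of_coe_addCircle_eq_zero (f := fun t : I => f t - t * c) (by fun_prop)
    (fun t => by rw [AddCircle.coe_sub, h, sub_self]) 1 0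
  simp at this
  linarith

lemma exists_lift_addCircle (f : C(ℝ≥0 × I, UnitAddCircle)) :
    ∃ Θ : C(ℝ≥0 × I, ℝ), ∀ x, (Θ x : UnitAddCircle) = f x := by
  -- The plane retracts onto the half-strip, so a lift over the simply connected plane restricts to
  -- the lift wanted.
  let q : C(ℝ × ℝ, ℝ≥0 × I) :=
    ⟨fun x => (x.1.toNNReal, Set.projIcc 0 1 zero_le_one x.2),
      (continuous_real_toNNReal.comp continuous_fst).prodMk
        (continuous_projIcc.comp continuous_snd)⟩
  obtain ⟨e, he⟩ := QuotientAddGroup.mk_surjective (f (q 0))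
  obtain ⟨Θ, ⟨-, hΘ⟩, -⟩ := (AddCircle.isCoveringMap_coe (1 : ℝ)).existsUnique_continuousMap_lifts
    (f.comp q) 0 e he
  refine ⟨Θ.comp ⟨fun x => ((x.1 : ℝ), (x.2 : ℝ)), by fun_prop⟩, fun x => ?_⟩
  refine (congrFun hΘ _).trans ?_
  simp [q]

end Winding

/-! ### The height function and the compactly supported circle map counting level crossings. -/

section Cocycle

open Classical in
/-- The indicator function of the elements of height at least `M`. -/
def upperInd {G : Type*} (p : G → ℤ) (M : ℤ) (g : G) : ℤ := if M ≤ p g then 1 else 0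

lemma upperInd_congr {G : Type*} {p : G → ℤ} {M : ℤ} {g h : G} (H : M ≤ p g ↔ M ≤ p h) :
    upperInd p M g = upperInd p M h := by
  unfold upperInd
  simp only [H]

lemma coe_intCast_addCircle (n : ℤ) : ((n : ℝ) : UnitAddCircle) = 0 :=
  AddCircle.coe_eq_zero_iff _ |>.2 ⟨n, by simp⟩

variable {G ι : Type*} [Group G] {s : ι → G} {R : Set (FreeGroup ι)}

lemma letterVal_congr {T : Type*} {e e' : G → ι → I → T} {P : Set G} {h : G} {l : ι × Bool}
    (h0 : h ∈ P) (h1 : h * letterElt s l ∈ P)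
    (H : ∀ g ∈ P, ∀ i, g * s i ∈ P → ∀ t, e g i t = e' g i t) (t : I) :
    letterVal s e h l t = letterVal s e' h l t := by
  unfold letterVal
  unfold letterElt at h1
  split_ifs at h1 ⊢
  · exact H _ h0 _ h1 _
  · exact H _ h1 _ (by simpa using h0) _

lemma letterVal_induction {T : Type*} {e : G → ι → I → T} {P : Set G} {A : Set T} {h : G}
    {l : ι × Bool} (h0 : h ∈ P) (h1 : h * letterElt s l ∈ P)
    (H : ∀ g ∈ P, ∀ i, g * s i ∈ P → ∀ t, e g i t ∈ A) (t : I) :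
    letterVal s e h l t ∈ A := by
  unfold letterVal
  unfold letterElt at h1
  split_ifs at h1 ⊢
  · exact H _ h0 _ h1 _
  · exact H _ h1 _ (by simpa using h0) _

lemma map_letterVal {T T' : Type*} (f : T → T') (e : G → ι → I → T) (h : G) (l : ι × Bool) (t : I) :
    f (letterVal s e h l t) = letterVal s (fun g i t => f (e g i t)) h l t := by
  unfold letterVal
  split_ifs <;> rfl

/-- A homomorphism to `ℤ` extends to a continuous height function on the complex. -/
theorem CayleyComplex.exists_height (hR : ∀ r ∈ R, FreeGroup.lift s r = 1) (p : G → ℤ)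
    (hp : ∀ g h, p (g * h) = p g + p h) (N : ℕ)
    (hN : ∀ r ∈ R, ∀ j, |p (prefixElt s r j)| ≤ N) :
    ∃ P : C(CayleyComplex s R, ℝ), (∀ g i t, P (edge s R (g, i) t) = p g + t * p (s i)) ∧
      ∀ g r z, |P (face s R g r z) - p g| ≤ N := by
  have hmem : ∀ g (r : R) j, g * prefixElt s r.1 j ∈ {h : G | |p h - p g| ≤ N} := fun g r j => by
    simpa [hp] using hN r.1 r.2 j
  obtain ⟨P, -, hPe, hPf⟩ := exists_extension hR (fun g => (p g : ℝ)) (linEdge s fun g => (p g : ℝ))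
    (continuous_linEdge _) (linEdge_zero _) (linEdge_one _)
    (fun g _ => Set.Icc (p g - N : ℝ) (p g + N)) (fun g r => by simp) (fun g r j hj t => by
      refine letterVal_induction (P := {h : G | |p h - p g| ≤ N}) (hmem g r j) ?_ ?_ t
      · rw [mul_assoc, ← prefixElt_succ s r.1 j hj]
        exact hmem g r _
      · intro h hh i hi t
        have e1 : |(p h : ℝ) - p g| ≤ N := by exact_mod_cast hh
        have e2 : |(p (h * s i) : ℝ) - p g| ≤ N := by exact_mod_cast hi
        rw [abs_le] at e1 e2
        unfold linEdge
        have := t.2.1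
        have := t.2.2
        constructor <;> nlinarith)
  refine ⟨P, fun g i t => ?_, fun g r z => ?_⟩
  · rw [hPe, linEdge, hp]
    push_cast
    ring
  · have := hPf g r z
    rw [abs_le]
    constructor <;> linarith [this.1, this.2]

open Classical in
/-- The coboundary of `upperInd`, cut off outside of `E`. -/
def cutCocycle (s : ι → G) (p : G → ℤ) (E : Set G) (M : ℤ) (g : G) (i : ι) : ℤ :=
  if g ∈ E then upperInd p M (g * s i) - upperInd p M g else 0

open Classical in
/-- The map to the circle defined by `cutCocycle`. -/
theorem CayleyComplex.exists_circle_map [Finite ι] (hRf : R.Finite)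
    (hR : ∀ r ∈ R, FreeGroup.lift s r = 1) (p : G → ℤ)
    (hp : ∀ g h, p (g * h) = p g + p h) (N : ℕ) (hs : ∀ i, |p (s i)| ≤ N)
    (hN : ∀ r ∈ R, ∀ j, |p (prefixElt s r j)| ≤ N) (E : Set G) (M : ℤ)
    (hE : ∀ g, |p g - M| ≤ N → ∀ r ∈ R, ∀ j, (g * prefixElt s r j ∈ E ↔ g ∈ E))
    (hfin : {g | g ∈ E ∧ |p g - M| ≤ N}.Finite) (P : C(CayleyComplex s R, ℝ))
    (hPe : ∀ g i t, P (edge s R (g, i) t) = p g + t * p (s i))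
    (hPf : ∀ g r z, |P (face s R g r z) - p g| ≤ N) :
    ∃ (F : C(CayleyComplex s R, UnitAddCircle)) (K : Set (CayleyComplex s R)), IsCompact K ∧
      (∀ x, F x ≠ 0 → x ∈ K) ∧ (∀ x, F x ≠ 0 → |P x - M| ≤ 2 * N) ∧
      ∀ g i t, F (edge s R (g, i) t) = ((t * cutCocycle s p E M g i : ℝ) : UnitAddCircle) := by
  obtain ⟨U, hUv, hUe, -⟩ := exists_extension hR (fun g => (upperInd p M g : ℝ))
    (linEdge s fun g => (upperInd p M g : ℝ))
    (continuous_linEdge _) (linEdge_zero _) (linEdge_one _)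
    (fun _ _ => Set.univ) (fun _ _ => trivial) (fun _ _ _ _ _ => trivial)
  have hcE : ∀ g i, cutCocycle s p E M g i ≠ 0 → g ∈ E ∧ |p g - M| ≤ N := by
    intro g i h
    unfold cutCocycle at h
    split_ifs at h with hg
    · refine ⟨hg, ?_⟩
      by_contra! hlt
      refine h (sub_eq_zero.2 (upperInd_congr ?_))
      have := abs_le.1 (hs i)
      rw [hp]
      rcases lt_abs.1 hlt with h' | h' <;> constructor <;> intro <;> omega
    · exact absurd rfl h
  -- `U` is integral at vertices, so modulo 1 it vanishes there. Around a 2-cell based in `E` near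
  -- the level all corners lie in `E`, so the cut-off is invisible and `U` modulo 1 fills the cell;
  -- around any other 2-cell the cocycle is zero and so is the filling.
  let w : G → R → UnitDisc → UnitAddCircle := fun g r z =>
    if g ∈ E ∧ |p g - M| ≤ N then (U (face s R g r z) : UnitAddCircle) else 0
  have hw : ∀ g r, Continuous (w g r) := by
    intro g r
    simp only [w]
    split_ifs
    · exact (AddCircle.continuous_mk' 1).comp (U.continuous.comp (continuous_face g r))
    · exact continuous_const
  have hUf : ∀ g (r : R) j (hj : j < r.1.toWord.length) (t : I),
      U (face s R g r (UnitDisc.bdry (((j : ℝ) + (t : ℝ)) / (r.1.toWord.length : ℝ)))) =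
        letterVal s (linEdge s fun g => (upperInd p M g : ℝ)) (g * prefixElt s r.1 j)
          r.1.toWord[j] t := by
    intro g r j hj t
    rw [face_bdry g r j hj, map_letterVal U]
    simp only [hUe]
  have hprefix : ∀ g (r : R) j (hj : j < r.1.toWord.length),
      g * prefixElt s r.1 j * letterElt s r.1.toWord[j] ∈ Set.range fun j => g * prefixElt s r.1 j :=
    fun g r j hj => ⟨j + 1, by simp only [mul_assoc, ← prefixElt_succ s r.1 j hj]⟩
  obtain ⟨F, hFv, hFe, hFf⟩ := exists_glue (s := s) (R := R) (fun _ => (0 : UnitAddCircle))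
    (fun g i t => ((t * cutCocycle s p E M g i : ℝ) : UnitAddCircle)) w
    (fun g i => (AddCircle.continuous_mk' 1).comp (by fun_prop)) hw
    (fun g i => by simp) (fun g i => by simp [coe_intCast_addCircle])
    (fun g r j hj t => by
      simp only [w]
      split_ifs with hg
      · rw [hUf g r j hj, map_letterVal (fun x : ℝ => (x : UnitAddCircle))]
        refine letterVal_congr (P := Set.range fun j => g * prefixElt s r.1 j) ⟨j, rfl⟩
          (hprefix g r j hj) ?_ t
        rintro _ ⟨k, rfl⟩ i - t
        have : g * prefixElt s r.1 k ∈ E := (hE g hg.2 r.1 r.2 k).2 hg.1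
        simp only [cutCocycle, if_pos this, linEdge, AddCircle.coe_add, coe_intCast_addCircle,
          zero_add, Int.cast_sub]
      · symm
        refine letterVal_induction (A := {0}) (P := Set.range fun j => g * prefixElt s r.1 j)
          ⟨j, rfl⟩ (hprefix g r j hj) ?_ t
        rintro _ ⟨k, rfl⟩ i ⟨k', hk'⟩ t
        -- If this corner is in `E`, then `g` is more than `N` away from level `M`; both ends of the
        -- edge are within `N` of the height of `g`, hence on the same side.
        have hc : cutCocycle s p E M (g * prefixElt s r.1 k) i = 0 := by
          unfold cutCocycle
          split_ifs with hmem
          · have hlt : ¬ |p g - M| ≤ N := fun h => hg ⟨(hE g h r.1 r.2 k).1 hmem, h⟩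
            refine sub_eq_zero.2 (upperInd_congr ?_)
            dsimp only at hk'
            rw [← hk', hp, hp]
            have e1 := abs_le.1 (hN r.1 r.2 k)
            have e2 := abs_le.1 (hN r.1 r.2 k')
            rcases lt_abs.1 (not_le.1 hlt) with h' | h' <;> constructor <;> intro <;> omega
          · rfl
        simp [hc])
    (fun g r hr θ => by
      simp only [w, face_bdry_trivial g r hr, hUv, coe_intCast_addCircle, ite_self])
  have hfaceF : ∀ g r z, F (face s R g r z) ≠ 0 → g ∈ E ∧ |p g - M| ≤ N := by
    intro g r z h
    by_contra h'
    exact h (by rw [hFf]; exact if_neg h')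
  have hedgeF : ∀ g i t, F (edge s R (g, i) t) ≠ 0 → g ∈ E ∧ |p g - M| ≤ N := by
    intro g i t h
    refine hcE g i fun h' => h ?_
    rw [hFe, h']
    simp
  have := hRf.to_subtype
  refine ⟨F, ⋃ g ∈ {g | g ∈ E ∧ |p g - M| ≤ N},
    ((⋃ i, Set.range (edge s R (g, i))) ∪ ⋃ r, Set.range (face s R g r)), ?_, ?_, ?_, hFe⟩
  · refine hfin.isCompact_biUnion fun g _ => ?_
    exact (isCompact_iUnion fun i => isCompact_range (continuous_edge _)).union
      (isCompact_iUnion fun r => isCompact_range (continuous_face _ _))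
  · intro x hx
    induction x using ind with
    | hv g => exact absurd (hFv g) hx
    | he g i t =>
      exact Set.mem_biUnion (hedgeF g i t hx) (.inl (Set.mem_iUnion.2 ⟨i, t, rfl⟩))
    | hf g r z =>
      exact Set.mem_biUnion (hfaceF g r z hx) (.inr (Set.mem_iUnion.2 ⟨r, z, rfl⟩))
  · intro x hx
    induction x using ind with
    | hv g => exact absurd (hFv g) hx
    | he g i t =>
      have e1 : |(p g : ℝ) - M| ≤ N := by exact_mod_cast (hedgeF g i t hx).2
      have e2 : |(p (s i) : ℝ)| ≤ N := by exact_mod_cast hs i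
      have e3 : |(t : ℝ) * p (s i)| ≤ N := by
        rw [abs_mul, abs_of_nonneg t.2.1]
        nlinarith [t.2.2, abs_nonneg (p (s i) : ℝ)]
      rw [hPe]
      rw [abs_le] at *
      constructor <;> linarith [e1.1, e1.2, e3.1, e3.2]
    | hf g r z =>
      have e1 : |(p g : ℝ) - M| ≤ N := by exact_mod_cast (hfaceF g r z hx).2
      have e2 := hPf g r z
      rw [abs_le] at *
      constructor <;> linarith [e1.1, e1.2, e2.1, e2.2]

end Cocycle

/-! ### The winding obstruction to a proper homotopy. -/

section NotSemistable

variable {G ι : Type*} [Group G] {s : ι → G} {R : Set (FreeGroup ι)}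

open Classical in
lemma finite_range_prefixElt (s : ι → G) (r : FreeGroup ι) :
    (Set.range (prefixElt s r)).Finite := by
  refine ((Set.finite_Iic r.toWord.length).image (prefixElt s r)).subset ?_
  rintro _ ⟨j, rfl⟩
  rcases le_total j r.toWord.length with h | h
  · exact ⟨j, h, rfl⟩
  · refine ⟨r.toWord.length, Set.mem_Iic.2 le_rfl, ?_⟩
    unfold prefixElt
    rw [List.take_of_length_le h, List.take_length]

/-- A ray in the complex along which the height function is linear is proper. -/
lemma isProperMap_of_height {X : Type*} [TopologicalSpace X] [T2Space X] {r : ℝ≥0 → X}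
    (hr : Continuous r) (P : C(X, ℝ)) {d : ℝ} (hd : d ≠ 0) (hP : ∀ t, P (r t) = d * t) :
    IsProperMap r := by
  refine isProperMap_of_comp_of_t2 hr P.continuous ?_
  have h1 : IsProperMap fun t : ℝ≥0 => (t : ℝ) :=
    (isClosed_Ici (a := (0 : ℝ))).isClosedEmbedding_subtypeVal.isProperMap
  have h2 : IsProperMap fun t : ℝ => d * t := (Homeomorph.mulLeft₀ d hd).isProperMap
  convert h2.comp h1 using 1
  funext t
  exact hP t

open CayleyComplex in
/-- If the kernel of a homomorphism `p` from `G` to `ℤ` is exhausted, near each level, by finite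
pieces that are stable under multiplication by bounded elements, then the two rays labelled by the
powers of a generator of positive height are not properly homotopic. -/
theorem not_semistableAtInfinity_of_height [Finite ι] (hRf : R.Finite)
    (hR : ∀ r ∈ R, FreeGroup.lift s r = 1) (p : G → ℤ) (hp : ∀ g h, p (g * h) = p g + p h)
    (i₀ : ι) (hi₀ : 0 < p (s i₀))
    (H : ∀ U : Set G, U.Finite → ∃ (N : ℕ) (E : Set G), (∀ u ∈ U, |p u| ≤ N) ∧ 1 ∈ E ∧
      (∀ g, |p g| ≤ N → ∀ u ∈ U, (g * u ∈ E ↔ g ∈ E)) ∧ {g | g ∈ E ∧ |p g| ≤ N}.Finite) :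
    ¬ SemistableAtInfinity (CayleyComplex.edge s R) := by
  obtain ⟨N, E, hUN, h1E, hUE, hfin⟩ := H (Set.range s ∪ ⋃ r ∈ R, Set.range (prefixElt s r))
    ((Set.finite_range s).union (hRf.biUnion fun r _ => finite_range_prefixElt s r))
  have hs : ∀ i, |p (s i)| ≤ N := fun i => hUN _ (.inl ⟨i, rfl⟩)
  have hN : ∀ r ∈ R, ∀ j, |p (prefixElt s r j)| ≤ N := fun r hr j =>
    hUN _ (.inr (Set.mem_biUnion hr ⟨j, rfl⟩))
  obtain ⟨P, hPe, hPf⟩ := exists_height hR p hp N hN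
  have := t2Space hR
  set a := s i₀ with ha
  set d := p a with hd
  let φ : G →* Multiplicative ℤ := MonoidHom.mk' (fun g => Multiplicative.ofAdd (p g))
    fun g h => by simp [hp]
  have hpz : ∀ n : ℤ, p (a ^ n) = n * d := fun n => by
    have := congrArg Multiplicative.toAdd (map_zpow φ a n)
    simpa [φ, hd] using this
  have hpinv : ∀ g, p g⁻¹ = - p g := fun g => by
    have := congrArg Multiplicative.toAdd (map_inv φ g)
    simpa [φ] using this
  have hd' : (0 : ℝ) < d := by exact_mod_cast hi₀
  -- The two rays.
  obtain ⟨r, hrc, hr⟩ := exists_ray (fun n => edge s R (a ^ (n : ℤ), i₀))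
    (fun n => continuous_edge _) (fun n => by
      rw [edge_one, edge_zero, ← ha, ← zpow_add_one]; push_cast; rfl)
  obtain ⟨r', hrc', hr'⟩ := exists_ray
    (fun n t => edge s R (a ^ (-(n : ℤ) - 1), i₀) (unitInterval.symm t))
    (fun n => (continuous_edge _).comp unitInterval.continuous_symm) (fun n => by
      simp only [unitInterval.symm_one, unitInterval.symm_zero]
      rw [edge_one, edge_zero, ← ha, ← zpow_add_one]; push_cast; congr 2; ring)
  have hdecomp : ∀ t : ℝ≥0, ∃ (n : ℕ) (u : I), t = n + unitInterval.toNNReal u := fun t =>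
    ⟨⌊t⌋₊, ⟨(t : ℝ) - ⌊t⌋₊, sub_nonneg.2 (by exact_mod_cast Nat.floor_le (zero_le (a := t))), by
      have : (t : ℝ) < ⌊t⌋₊ + 1 := by exact_mod_cast Nat.lt_floor_add_one t
      linarith⟩, by ext; simp⟩
  have hrP : ∀ t, P (r t) = d * t := by
    intro t
    obtain ⟨n, u, rfl⟩ := hdecomp t
    rw [hr, hPe, hpz]
    push_cast
    simp only [unitInterval.coe_toNNReal]
    ring
  have hrP' : ∀ t, P (r' t) = (-d) * t := by
    intro t
    obtain ⟨n, u, rfl⟩ := hdecomp t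
    rw [hr', hPe, hpz]
    push_cast
    simp only [unitInterval.coe_toNNReal, unitInterval.coe_symm_eq]
    ring
  intro hsemi
  obtain ⟨H, hH, hH0, hH1⟩ := hsemi r r'
    ⟨isProperMap_of_height hrc P hd'.ne' hrP, fun n => ⟨_, .inl (hr n)⟩⟩
    ⟨isProperMap_of_height hrc' P (neg_ne_zero.2 hd'.ne') hrP', fun n => ⟨_, .inr (hr' n)⟩⟩
  -- A level `k * d` above the track of the base point.
  obtain ⟨B, hB⟩ := (isCompact_range (f := fun t : I => P (H (0, t)))
    (P.continuous.comp (hH.continuous.comp (by fun_prop)))).bddAbove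
  -- `F` will vanish at heights more than `2 * N` from `k * d`, and `d ≥ 1`, so it vanishes at
  -- heights up to `B`. The maximum with 0 makes the upward ray start below the level.
  obtain ⟨k, hk⟩ := exists_nat_gt (max 0 (B + 2 * N))
  have hkpos : (0 : ℤ) < k := by
    have := (le_max_left _ _).trans_lt hk
    exact_mod_cast this
  have hkB : B + 2 * N < k * d := by
    have h1 := (le_max_right _ _).trans_lt hk
    have h2 : (1 : ℝ) ≤ d := by exact_mod_cast hi₀
    nlinarith [(le_max_left _ _).trans_lt hk]
  set M : ℤ := k * d with hM
  have hMpos : 0 < M := mul_pos hkpos hi₀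
  -- Left translation by `a ^ k` moves the piece from level 0 to level `M` and respects stability
  -- under right multiplication.
  let E' : Set G := {g | a ^ (-(k : ℤ)) * g ∈ E}
  have hpt : ∀ g, p (a ^ (-(k : ℤ)) * g) = p g - M := fun g => by rw [hp, hpz]; ring
  obtain ⟨F, K, hK, hFK, hFP, hFe⟩ := exists_circle_map hRf hR p hp N hs hN E' M
    (fun g hg r hr j => by
      simp only [E', Set.mem_ofPred_eq, ← mul_assoc]
      exact hUE _ (by rwa [hpt]) _ (.inr (Set.mem_biUnion hr ⟨j, rfl⟩)))
    ((hfin.image fun g => a ^ (k : ℤ) * g).subset fun g hg =>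
      ⟨a ^ (-(k : ℤ)) * g, ⟨hg.1, by rw [hpt]; exact hg.2⟩, by simp⟩) P hPe hPf
  obtain ⟨Θ, hΘ⟩ := exists_lift_addCircle (F.comp ⟨H, hH.continuous⟩)
  simp only [ContinuousMap.comp_apply, ContinuousMap.coe_mk] at hΘ
  have htrack : Θ (0, 1) = Θ (0, 0) := by
    refine eq_of_coe_addCircle_eq_zero (f := fun t : I => Θ (0, t)) (by fun_prop) (fun t => ?_) 1 0
    rw [hΘ]
    by_contra hne
    have h1 := (abs_le.1 (hFP _ hne)).1
    have h2 := hB ⟨t, rfl⟩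
    rw [hM] at h1
    push_cast at h1
    dsimp only at h2
    linarith
  -- Properness bounds the times at which `H` meets `K`; `T ≥ k` ensures that the upward ray has
  -- reached the level.
  obtain ⟨T, hTk, hT⟩ : ∃ T : ℕ, k ≤ T ∧ ∀ t : I, F (H (T, t)) = 0 := by
    obtain ⟨C, hC⟩ := ((hH.isCompact_preimage hK).image continuous_fst).bddAbove
    obtain ⟨T, hT⟩ := exists_nat_gt C
    refine ⟨max k T, le_max_left _ _, fun t => ?_⟩
    by_contra hne
    have h1 : ((max k T : ℕ) : ℝ≥0) ≤ C := hC ⟨(_, t), hFK _ hne, rfl⟩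
    have h2 : (T : ℝ≥0) ≤ (max k T : ℕ) := by exact_mod_cast le_max_right _ _
    exact absurd (h2.trans h1) (not_le.2 hT)
  have hend : Θ (T, 1) = Θ (T, 0) :=
    eq_of_coe_addCircle_eq_zero (f := fun t : I => Θ (T, t)) (by fun_prop)
      (fun t => by rw [hΘ, hT]) 1 0
  have hcr : ∀ n : ℕ, cutCocycle s p E' M (a ^ (n : ℤ)) i₀ =
      upperInd p M (a ^ ((n : ℤ) + 1)) - upperInd p M (a ^ (n : ℤ)) := by
    intro n
    unfold cutCocycle
    rw [← ha, ← zpow_add_one]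
    split_ifs with hmem
    · rfl
    · refine (sub_eq_zero.2 (upperInd_congr ?_)).symm
      rw [hpz, hpz, hM, mul_le_mul_iff_left₀ hi₀, mul_le_mul_iff_left₀ hi₀]
      -- The only crossing edge starts at `a ^ (k - 1)`, which lies in `E'`: stability under `a`
      -- puts `a⁻¹` in `E` because `a⁻¹ * a = 1` is. So the cut-off does not remove the crossing.
      have hne : (n : ℤ) + 1 ≠ k := by
        intro h
        refine hmem ?_
        have h3 : a ^ (-(k : ℤ)) * a ^ (n : ℤ) = a⁻¹ := by
          rw [← zpow_add, ← zpow_neg_one]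
          congr 1
          omega
        change a ^ (-(k : ℤ)) * a ^ (n : ℤ) ∈ E
        rw [h3, ← hUE _ (by rw [hpinv, abs_neg]; exact hs i₀) a (.inl ⟨i₀, rfl⟩),
          inv_mul_cancel]
        exact h1E
      omega
  have hcr' : ∀ n : ℕ, cutCocycle s p E' M (a ^ (-(n : ℤ) - 1)) i₀ = 0 := by
    intro n
    unfold cutCocycle
    rw [← ha, ← zpow_add_one]
    split_ifs with hmem
    · refine sub_eq_zero.2 (upperInd_congr ?_)
      rw [hpz, hpz, hM, mul_le_mul_iff_left₀ hi₀, mul_le_mul_iff_left₀ hi₀]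
      omega
    · rfl
  have step : ∀ (b : I) (n : ℕ) (c : ℤ), (∀ u : I, F (H (n + unitInterval.toNNReal u, b)) =
      ((u * (c : ℝ) : ℝ) : UnitAddCircle)) → Θ ((n + 1 : ℕ), b) = Θ (n, b) + c := by
    intro b n c hc
    have := eq_add_of_coe_addCircle_eq (f := fun u : I => Θ (n + unitInterval.toNNReal u, b))
      (by fun_prop) c (fun u => by rw [hΘ, hc])
    simpa using this
  have hsum : ∀ n : ℕ, Θ (n, 0) = Θ (0, 0) + upperInd p M (a ^ (n : ℤ)) - upperInd p M 1 := by
    intro n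
    induction n with
    | zero => simp
    | succ n ih =>
      rw [step 0 n _ fun u => by rw [hH0, hr, hFe, hcr], ih]
      push_cast
      ring
  have hsum' : ∀ n : ℕ, Θ (n, 1) = Θ (0, 1) := by
    intro n
    induction n with
    | zero => simp
    | succ n ih =>
      rw [step 1 n 0 fun u => by rw [hH1, hr', hFe, hcr']; simp, ih]
      simp
  have h1 : upperInd p M 1 = 0 := if_neg (by have := hpz 0; simp at this; omega)
  have h2 : upperInd p M (a ^ (T : ℤ)) = 1 := if_pos (by
    rw [hpz, hM, mul_le_mul_iff_left₀ hi₀]; exact_mod_cast hTk)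
  -- Comparing the four sides of `[0, T] × I` gives `1 = 0`.
  have h3 := hsum T
  rw [← hend, hsum', htrack, h1, h2] at h3
  norm_num at h3

/-- If a finitely generated group maps onto `ℤ` with locally finite kernel, then its complex
`Γ(G, S, R)` is not semistable at infinity, for any finite `S` and `R`. -/
theorem not_semistableAtInfinity_of_locallyFinite_ker [Finite ι]
    (hs : Subgroup.closure (Set.range s) = ⊤) (hRf : R.Finite)
    (hR : ∀ r ∈ R, FreeGroup.lift s r = 1) (p : G →* Multiplicative ℤ) (x : G)
    (hx : p x = Multiplicative.ofAdd 1)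
    (hker : ∀ T : Set G, T.Finite → T ⊆ p.ker → Finite (Subgroup.closure T)) :
    ¬ SemistableAtInfinity (CayleyComplex.edge s R) := by
  have hx' : ∀ n : ℤ, p (x ^ n) = Multiplicative.ofAdd n := fun n => by
    rw [map_zpow, hx, ← ofAdd_zsmul]; simp
  have H : ∀ U : Set G, U.Finite → ∃ (N : ℕ) (E : Set G), (∀ u ∈ U, |(p u).toAdd| ≤ N) ∧ 1 ∈ E ∧
      (∀ g, |(p g).toAdd| ≤ N → ∀ u ∈ U, (g * u ∈ E ↔ g ∈ E)) ∧
      {g | g ∈ E ∧ |(p g).toAdd| ≤ N}.Finite := by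
    intro U hU
    obtain ⟨B, hB⟩ := (hU.image fun u => (p u).toAdd.natAbs).bddAbove
    have hB' : ∀ u ∈ U, |(p u).toAdd| ≤ B := fun u hu => by
      have := hB ⟨u, hu, rfl⟩
      rw [Int.abs_eq_natAbs]
      exact_mod_cast this
    -- For `g` of height `m`, passing from `g` to `g * u` multiplies `g * x ^ (-m)` on the right by
    -- `c (m, u)`, an element of the kernel; only `|m| ≤ B` matters, so finitely many occur.
    let c : ℤ × G → G := fun z => x ^ z.1 * (z.2 * x ^ (-(p z.2).toAdd)) * x ^ (-z.1)
    let T : Set G := c '' (Set.Icc (-B : ℤ) B ×ˢ U)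
    have hTfin : T.Finite := ((Set.finite_Icc _ _).prod hU).image c
    have hTker : T ⊆ p.ker := by
      rintro _ ⟨z, -, rfl⟩
      rw [SetLike.mem_coe, MonoidHom.mem_ker, ← toAdd_eq_zero]
      simp [c, hx]
    have := hker T hTfin hTker
    refine ⟨B, {g | g * x ^ (-(p g).toAdd) ∈ Subgroup.closure T}, hB', by simp, ?_, ?_⟩
    · intro g hg u hu
      have hmem : c ((p g).toAdd, u) ∈ Subgroup.closure T :=
        Subgroup.subset_closure ⟨_, ⟨abs_le.1 hg, hu⟩, rfl⟩
      have heq : g * u * x ^ (-(p (g * u)).toAdd) =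
          g * x ^ (-(p g).toAdd) * c ((p g).toAdd, u) := by
        have : -(p (g * u)).toAdd = -(p u).toAdd + -(p g).toAdd := by
          rw [map_mul, toAdd_mul]; ring
        rw [this, zpow_add]
        simp only [c]
        group
      rw [Set.mem_ofPred_eq, heq, Subgroup.mul_mem_cancel_right _ hmem, Set.mem_ofPred_eq]
    · refine Set.Finite.subset ((((Subgroup.closure T : Set G).toFinite).prod
        (Set.finite_Icc (-B : ℤ) B)).image fun z => z.1 * x ^ z.2) ?_
      rintro g ⟨hg, hgB⟩
      exact ⟨(g * x ^ (-(p g).toAdd), (p g).toAdd), ⟨hg, abs_le.1 hgB⟩, by simp⟩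
  -- `x` need not be a generator, but some generator has nonzero height. If that height is negative,
  -- `-p` replaces `p`, as `H` involves only absolute values of heights.
  obtain ⟨i, hi⟩ : ∃ i, (p (s i)).toAdd ≠ 0 := by
    by_contra! h
    have : (⊤ : Subgroup G) ≤ p.ker := by
      rw [← hs, Subgroup.closure_le]
      rintro _ ⟨i, rfl⟩
      exact h i
    have h1 : p x = 1 := this (Subgroup.mem_top x)
    rw [hx] at h1
    exact absurd (congrArg Multiplicative.toAdd h1) (by simp)
  rcases hi.lt_or_gt with hi | hi
  · refine not_semistableAtInfinity_of_height hRf hR (fun g => -(p g).toAdd)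
      (fun g h => by rw [map_mul, toAdd_mul]; ring) i (by omega) ?_
    simpa only [abs_neg] using H
  · exact not_semistableAtInfinity_of_height hRf hR (fun g => (p g).toAdd)
      (fun g h => by rw [map_mul, toAdd_mul]) i hi H

end NotSemistable

/-! ### The Lamplighter group has locally finite kernel over `ℤ`. -/

namespace Lamplighter

/-- The conjugate `x⁻ᵏ a xᵏ`. -/
def lamp (k : ℤ) : Lamplighter := gen .x ^ (-k) * gen .a * gen .x ^ k

lemma conj_lamp (k m : ℤ) : gen .x ^ (-m) * lamp k * gen .x ^ m = lamp (k + m) := by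
  unfold lamp
  group

lemma gen_a_sq : gen .a ^ 2 = 1 :=
  (PresentedGroup.one_of_mem (rels := lamplighterRels) (.inl rfl) :)

lemma commute_lamp_zero (k : ℤ) : Commute (gen .a) (lamp k) :=
  commutatorElement_eq_one_iff_commute.1
    (PresentedGroup.one_of_mem (rels := lamplighterRels) (.inr ⟨k, rfl⟩) :)

/-- Conjugation by a power of `x` reduces the pair `k, m` to `0, m - k`, which is a defining
relator. -/
lemma commute_lamp (k m : ℤ) : lamp k * lamp m = lamp m * lamp k := by
  have h := (commute_lamp_zero (m - k)).eq
  have e1 : lamp k = gen .x ^ (-k) * gen .a * gen .x ^ k := rfl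
  have e2 : lamp m = gen .x ^ (-k) * lamp (m - k) * gen .x ^ k := by rw [conj_lamp]; simp
  rw [e1, e2]
  calc _ = gen .x ^ (-k) * (gen .a * lamp (m - k)) * gen .x ^ k := by group
    _ = gen .x ^ (-k) * (lamp (m - k) * gen .a) * gen .x ^ k := by rw [h]
    _ = _ := by group

lemma lamp_sq (k : ℤ) : lamp k ^ 2 = 1 := by
  have : lamp k ^ 2 = gen .x ^ (-k) * gen .a ^ 2 * gen .x ^ k := by
    unfold lamp
    rw [pow_two, pow_two]
    group
  rw [this, gen_a_sq]
  group

/-- The subgroup of lamp configurations. -/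
def lamps : Subgroup Lamplighter := Subgroup.closure (Set.range lamp)

lemma lamps_comm {g h : Lamplighter} (hg : g ∈ lamps) (hh : h ∈ lamps) : g * h = h * g := by
  have : IsMulCommutative lamps := Subgroup.isMulCommutative_closure (by
    rintro _ ⟨k, rfl⟩ _ ⟨m, rfl⟩
    exact commute_lamp k m)
  exact setLike_mul_comm hg hh

lemma lamps_sq {g : Lamplighter} (hg : g ∈ lamps) : g ^ 2 = 1 := by
  unfold lamps at hg
  induction hg using Subgroup.closure_induction with
  | mem g hg => obtain ⟨k, rfl⟩ := hg; exact lamp_sq k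
  | one => simp
  | mul g h hg hh ihg ihh =>
    rw [(show Commute g h from lamps_comm hg hh).mul_pow, ihg, ihh, one_mul]
  | inv g hg ih => rw [inv_pow, ih, inv_one]

/-- The position of the lamplighter. -/
def position : Lamplighter →* Multiplicative ℤ :=
  PresentedGroup.toGroup (rels := lamplighterRels)
    (f := fun i => match i with | .a => 1 | .x => Multiplicative.ofAdd 1) (by
      rintro r (rfl | ⟨k, rfl⟩)
      · simp
      · simp)

lemma position_a : position (gen .a) = 1 := PresentedGroup.toGroup.of _

lemma position_x : position (gen .x) = Multiplicative.ofAdd 1 := PresentedGroup.toGroup.of _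

lemma closure_range_gen : Subgroup.closure (Set.range gen) = ⊤ :=
  PresentedGroup.closure_range_of lamplighterRels

/-- Induction on a word for `g`: a letter `a` or its inverse multiplies the element by a lamp or its
inverse, with index minus the current position, and a letter `x` or its inverse leaves it unchanged.
-/
lemma mul_zpow_mem_lamps (g : Lamplighter) : g * gen .x ^ (-(position g).toAdd) ∈ lamps := by
  have hlamp : ∀ k, lamp k ∈ lamps := fun k => Subgroup.subset_closure ⟨k, rfl⟩
  have hg : g ∈ Subgroup.closure (Set.range gen) := closure_range_gen ▸ Subgroup.mem_top g
  induction hg using Subgroup.closure_induction_right with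
  | one => simp [lamps.one_mem]
  | mul_right g _ y hy ih =>
    obtain ⟨_ | _, rfl⟩ := hy
    · have : g * gen .a * gen .x ^ (-(position (g * gen .a)).toAdd) =
          g * gen .x ^ (-(position g).toAdd) * lamp (-(position g).toAdd) := by
        rw [map_mul, position_a, mul_one]
        unfold lamp
        group
      rw [this]
      exact lamps.mul_mem ih (hlamp _)
    · convert ih using 1
      rw [map_mul, position_x, toAdd_mul, toAdd_ofAdd]
      group
  | mul_inv_cancel g _ y hy ih =>
    obtain ⟨_ | _, rfl⟩ := hy
    · have : g * (gen .a)⁻¹ * gen .x ^ (-(position (g * (gen .a)⁻¹)).toAdd) =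
          g * gen .x ^ (-(position g).toAdd) * (lamp (-(position g).toAdd))⁻¹ := by
        rw [map_mul, map_inv, position_a, inv_one, mul_one]
        unfold lamp
        group
      rw [this]
      exact lamps.mul_mem ih (lamps.inv_mem (hlamp _))
    · convert ih using 1
      rw [map_mul, map_inv, position_x, toAdd_mul, toAdd_inv, toAdd_ofAdd]
      group

lemma ker_position_le : position.ker ≤ lamps := by
  intro g hg
  have := mul_zpow_mem_lamps g
  rw [MonoidHom.mem_ker.1 hg] at this
  simpa using this

/-- The kernel lies in an abelian group of exponent 2, and a finitely generated abelian torsion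
group is finite. -/
lemma finite_closure_of_subset_ker {T : Set Lamplighter} (hT : T.Finite)
    (hTk : T ⊆ position.ker) : Finite (Subgroup.closure T) := by
  have hle : Subgroup.closure T ≤ lamps :=
    (Subgroup.closure_le _).2 (hTk.trans ker_position_le)
  let _ : CommGroup (Subgroup.closure T) :=
    { (inferInstance : Group (Subgroup.closure T)) with
      mul_comm := fun g h => Subtype.ext (lamps_comm (hle g.2) (hle h.2)) }
  have : Group.FG (Subgroup.closure T) :=
    (Group.fg_iff_subgroup_fg _).2 ⟨hT.toFinset, by simp⟩
  refine CommGroup.finite_of_fg_isMulTorsion _ fun g =>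
    isOfFinOrder_iff_pow_eq_one.2 ⟨2, two_pos, Subtype.ext (lamps_sq (hle g.2))⟩

/-- An arbitrary finite generating family is allowed, so that both claims of the theorem are
instances. -/
theorem not_semistableAtInfinity {ι : Type*} [Finite ι] {s : ι → Lamplighter}
    (hs : Subgroup.closure (Set.range s) = ⊤) {R : Set (FreeGroup ι)} (hRf : R.Finite)
    (hR : ∀ r ∈ R, FreeGroup.lift s r = 1) :
    ¬ SemistableAtInfinity (CayleyComplex.edge s R) :=
  not_semistableAtInfinity_of_locallyFinite_ker hs hRf hR position (gen .x) position_x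
    fun _ => finite_closure_of_subset_ker

end Lamplighter

end

theorem theorem1 :
    ¬ Group.SemistableAtInfinity Lamplighter ∧
    ∀ R : Set (FreeGroup LampGen), R.Finite →
      (∀ r ∈ R, FreeGroup.lift Lamplighter.gen r = 1) →
      ¬ SemistableAtInfinity (CayleyComplex.edge Lamplighter.gen R) := by
  constructor
  · rintro ⟨S, R, hS, hSc, hRf, hR, hsemi⟩
    have := hS.to_subtype
    exact Lamplighter.not_semistableAtInfinity (by rwa [Subtype.range_coe]) hRf hR hsemi
  · intro R hRf hR
    have : Finite LampGen := Finite.of_surjective (fun b : Bool => if b then LampGen.a else .x)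
      (by rintro (_ | _); exacts [⟨true, rfl⟩, ⟨false, rfl⟩])
    exact Lamplighter.not_semistableAtInfinity Lamplighter.closure_range_gen hRf hR
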